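/- A topological dynamical system $(X,T)$ is a compact metric space $(X,d)$ with a continuous map $T:X\to X$; its eventual image is $E_T=\bigcap_{i\ge 1}T^i(X)$. We say that $(X,T)$ has the specification property if $E_T$ contains more than one point and for every $\varepsilon>0$ there is an integer $u\ge 0$ such that for all $n\ge 1$, all $x^{(1)},\dots,x^{(n)}\in E_T$ and all integers $r_1,\dots,r_n\ge 1$ there is $z\in E_T$ with $$d\bigl(T^{(r_1+u)+\dots+(r_{i-1}+u)+j}z,\;T^{j}x^{(i)}\bigr)<\varepsilon\qquad(1\le i\le n,\ 0\le j<r_i).$$ We say that $(X,T)$ is Bohr chaotic if for every bounded real sequence $(a_n)_{n\ge 0}$ with $\limsup_{N\to\infty}\frac1N\sum_{n=0}^{N-1}|a_n|>0$ there are a point $x\in X$ and a continuous function $f:X\to\mathbb R$ with $$\limsup_{N\to\infty}\frac1N\Bigl|\sum_{n=0}^{N-1}a_n f(T^n x)\Bigr|>0.$$ Theorem. Let $(X,T)$ be a topological dynamical system. Suppose that there are a closed set $Y\subseteq X$ and an integer $k>0$ such that $T^k(Y)\subseteq Y$ and the system $(Y,T^k|_Y)$ (with the metric inherited from $X$) has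 the specification property. Then $(X,T)$ is Bohr chaotic. -/

import Mathlib

namespace TopDyn

/-- The eventual image `⋂_{i ≥ 1} T^i(X)` of a self-map `T : X → X`. -/
def eventualImage {X : Type*} (T : X → X) : Set X :=
  ⋂ (i : ℕ) (_ : 1 ≤ i), Set.range (T^[i])

/-- The orbit segment `z, T z, …, T^{r-1} z` `ε`-shadows the sequence `w 0, …, w (r-1)`
(only the first `r` terms of `w` matter). -/
def Shadows {X : Type*} [MetricSpace X] (T : X → X) (ε : ℝ) (r : ℕ) (z : X) (w : ℕ → X) : Prop :=
  ∀ j < r, dist (T^[j] z) (w j) < ε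

/-- The specification property of `(X, T)`: the eventual image has more than one point, and for
every `ε > 0` there is a spacing `u` such that any finite family of (nonempty) orbit segments
`x i, T (x i), …, T^{r i - 1} (x i)` in the eventual image is `ε`-shadowed, in the given order and
with gaps of exactly `u`, by the orbit of a single point of the eventual image. The `i`-th segment
starts at time `∑_{m < i} (r m + u)`. -/
structure HasSpecification {X : Type*} [MetricSpace X] (T : X → X) : Prop where
  nontrivial : (eventualImage T).Nontrivial
  exists_shadowing : ∀ ε : ℝ, 0 < ε → ∃ u : ℕ,
    ∀ (n : ℕ) (x : Fin n → X) (r : Fin n → ℕ),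
      (∀ i, x i ∈ eventualImage T) → (∀ i, 1 ≤ r i) →
      ∃ z ∈ eventualImage T, ∀ i : Fin n,
        Shadows T ε (r i) (T^[∑ m ∈ Finset.Iio i, (r m + u)] z) (fun j => T^[j] (x i))

/-- A bounded real sequence `a` is non-trivial if `limsup (1/N) ∑_{n<N} |a n| > 0`. -/
def IsNontrivialSeq (a : ℕ → ℝ) : Prop :=
  0 < Filter.limsup (fun N : ℕ => (1 / (N : ℝ)) * ∑ n ∈ Finset.range N, |a n|) Filter.atTop

/-- `(X, T)` is Bohr chaotic: every non-trivial bounded real sequence correlates with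
`(f (T^n x))_n` for some point `x` and some continuous real function `f`. (All the averages are
bounded, as `X` is compact, so the real-valued `limsup` is the usual one.) -/
def IsBohrChaotic {X : Type*} [MetricSpace X] [CompactSpace X] (T : X → X) : Prop :=
  ∀ a : ℕ → ℝ, (∃ C : ℝ, ∀ n, |a n| ≤ C) → IsNontrivialSeq a →
    ∃ (x : X) (f : C(X, ℝ)),
      0 < Filter.limsup
        (fun N : ℕ => (1 / (N : ℝ)) * |∑ n ∈ Finset.range N, a n * f (T^[n] x)|) Filter.atTop

end TopDyn

/-!
Write `S = T^k`, and let `E` be the eventual image of `(Y, S)`. The idea is to find a continuous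
`F` and a period `L` such that every set of times inside one residue class modulo `L` is the set of
`n` with `F (T^n x) = 1` for some `x`, while `F (T^n x) = 0` at all other times
(`exists_continuous_indicator_of_residue`). Given a non-trivial bounded sequence `a`, split the
times by their residue modulo `L` and by the sign of `a n`; one of these finitely many sets `P`
carries a positive upper average of `|a n|`, and the point with `F (T^n x) = 1_P n` correlates with
`a` (`isBohrChaotic_of_indicator`).

What makes this delicate is that specification gives no control over the orbit in the gaps between
the prescribed pieces, nor a priori at the times that are not multiples of `k`. The latter are
handled by uniform continuity: infinitely many orbit pieces, measured in `T`-time, can be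
glued with a constant gap (`links_of_hasSpecification`). The gaps are handled in three steps.

* There are points `a, w ∈ E` such that the whole `T`-orbit of `a` stays at distance `≥ ρ` from `w`
  (`exists_orbit_avoiding`). Otherwise `E` is covered by finitely many images `T^s M`, where `M`
  consists of the points whose orbit is near some `p` at all multiples of a time `V`; by Baire and
  the mixing that specification provides, `E ⊆ T^s M` for a single `s`, and iterating this inclusion
  gives `E ⊆ M`, which is absurd.
* Glue long runs of the orbit of `a` with two single visits to `w` that are far apart, giving
  a point `e`. Its orbit can approach `w` only in two windows of bounded length, so some spherical
  shell around `w` is not met at all, and the thickness `2 * η` of the shell depends on the length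
  of the windows but not on the distance `D` between them (`Links.exists_isMarkedSegment`).
* Now choose `D` larger than the gap `g` belonging to the scale `η / 2`, and glue copies of the
  segment of `e` and of the orbit of `a`, at will. Thanks to the shell, shadowing preserves exactly
  which times are visits to the ball around `w`. With `Δ` the time between the first and the last
  visit of `e`, two visits at distance `Δ` occur only as the first and last visit of one copy of `e`: a gap
  is too short to contain both, and the long runs of the orbit of `a` separate a gap from everything
  else. Hence `F x = h x * h (T^Δ x)`, with `h` a bump function at `w`, is as required.
-/

open Filter Topology

/-! ### Gluing orbit pieces -/

/-- `E` is a compact set with more than one point, invariant under `T^k`, in which infinitely many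
orbit pieces can be glued: the `i`-th piece has length `r i` and consecutive pieces are
separated by gaps of a length `g` depending only on the precision. All times refer to `T`, not to
`T^k`; only pieces and gaps whose lengths are multiples of `k` are considered. -/
structure Links {X : Type*} [MetricSpace X] (T : X → X) (E : Set X) (k : ℕ) : Prop where
  isCompact : IsCompact E
  nontrivial : E.Nontrivial
  mapsTo : Set.MapsTo (T^[k]) E E
  exists_glue : ∀ ε : ℝ, 0 < ε → ∃ g : ℕ, k ∣ g ∧ ∀ (x : ℕ → X) (r : ℕ → ℕ),
    (∀ i, x i ∈ E) → (∀ i, k ∣ r i ∧ 0 < r i) →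
      ∃ z ∈ E, ∀ i, ∀ j < r i,
        dist (T^[∑ m ∈ Finset.range i, (r m + g) + j] z) (T^[j] (x i)) < ε

theorem isCompact_eventualImage {X : Type*} [MetricSpace X] [CompactSpace X] {T : X → X}
    (hT : Continuous T) : IsCompact (TopDyn.eventualImage T) := by
  refine IsClosed.isCompact ?_
  refine isClosed_iInter fun i => isClosed_iInter fun _ => ?_
  exact (isCompact_range (hT.iterate i)).isClosed

theorem mapsTo_eventualImage {X : Type*} (T : X → X) :
    Set.MapsTo T (TopDyn.eventualImage T) (TopDyn.eventualImage T) := by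
  intro x hx
  simp only [TopDyn.eventualImage, Set.mem_iInter] at hx ⊢
  intro i hi
  obtain ⟨y, rfl⟩ := hx i hi
  exact ⟨T y, Function.iterate_succ_apply' T i y ▸ (Function.iterate_succ_apply T i y).symm⟩

/-- By compactness, specification holds for infinite families of orbit segments as well. -/
theorem exists_glue_infinite {X : Type*} [MetricSpace X] [CompactSpace X] {T : X → X}
    (hT : Continuous T) (h : TopDyn.HasSpecification T) {ε : ℝ} (hε : 0 < ε) :
    ∃ u : ℕ, ∀ (x : ℕ → X) (r : ℕ → ℕ), (∀ i, x i ∈ TopDyn.eventualImage T) →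
      (∀ i, 1 ≤ r i) → ∃ z ∈ TopDyn.eventualImage T, ∀ i, ∀ j < r i,
        dist (T^[∑ m ∈ Finset.range i, (r m + u) + j] z) (T^[j] (x i)) < ε := by
  obtain ⟨u, hu⟩ := h.exists_shadowing (ε / 2) (half_pos hε)
  refine ⟨u, fun x r hx hr => ?_⟩
  let K : ℕ → Set X := fun N => TopDyn.eventualImage T ∩ {z | ∀ i < N, ∀ j < r i,
    dist (T^[∑ m ∈ Finset.range i, (r m + u) + j] z) (T^[j] (x i)) ≤ ε / 2}
  have hclosed : ∀ N, IsClosed (K N) := by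
    intro N
    refine (isCompact_eventualImage hT).isClosed.inter ?_
    simp only [Set.ofPred_forall]
    refine isClosed_iInter fun i => isClosed_iInter fun _ => isClosed_iInter fun j =>
      isClosed_iInter fun _ => ?_
    exact isClosed_le ((hT.iterate _).dist continuous_const) continuous_const
  have hne : ∀ N, (K N).Nonempty := by
    intro N
    obtain ⟨z, hz, hsh⟩ := hu N (fun i => x i) (fun i => r i) (fun i => hx i) (fun i => hr i)
    refine ⟨z, hz, fun i hi j hj => ?_⟩
    have := hsh ⟨i, hi⟩ j hj
    have hsum : ∑ m ∈ Finset.Iio (⟨i, hi⟩ : Fin N), (r m + u)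
        = ∑ m ∈ Finset.range i, (r m + u) := by
      rw [← Nat.Iio_eq_range, ← Fin.map_valEmbedding_Iio (⟨i, hi⟩ : Fin N), Finset.sum_map]
      rfl
    rw [hsum, ← Function.iterate_add_apply, add_comm j] at this
    exact this.le
  obtain ⟨z, hz⟩ := IsCompact.nonempty_iInter_of_sequence_nonempty_isCompact_isClosed K
    (fun N z hz => ⟨hz.1, fun i hi => hz.2 i (hi.trans (Nat.lt_succ_self N))⟩) hne
    (hclosed 0).isCompact hclosed
  rw [Set.mem_iInter] at hz
  refine ⟨z, (hz 0).1, fun i j hj => ?_⟩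
  exact ((hz (i + 1)).2 i (Nat.lt_succ_self i) j hj).trans_lt (half_lt_self hε)

theorem exists_modulus_iterate {X : Type*} [MetricSpace X] [CompactSpace X] {T : X → X}
    (hT : Continuous T) (k : ℕ) {ε : ℝ} (hε : 0 < ε) :
    ∃ δ > 0, ∀ s < k, ∀ x y, dist x y < δ → dist (T^[s] x) (T^[s] y) < ε := by
  induction k with
  | zero => exact ⟨1, one_pos, fun s hs => absurd hs (Nat.not_lt_zero s)⟩
  | succ k ih =>
    obtain ⟨δ, hδ, h⟩ := ih
    obtain ⟨δ', hδ', h'⟩ := Metric.uniformContinuous_iff.1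
      (CompactSpace.uniformContinuous_of_continuous (hT.iterate k)) ε hε
    refine ⟨min δ δ', lt_min hδ hδ', fun s hs x y hxy => ?_⟩
    rcases Nat.lt_succ_iff_lt_or_eq.1 hs with hs | rfl
    · exact h s hs x y (hxy.trans_le (min_le_left _ _))
    · exact h' (hxy.trans_le (min_le_right _ _))

/-- The eventual image of `(Y, T^k)`, as a subset of `X`, admits gluing in `T`-time. The
intermediate times are controlled by the uniform continuity of `T^s` for `s < k`. -/
theorem links_of_hasSpecification {X : Type*} [MetricSpace X] [CompactSpace X]
    {T : X → X} (hT : Continuous T) {Y : Set X} (hY : IsClosed Y) {k : ℕ} (hk : 0 < k)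
    (hinv : Set.MapsTo (T^[k]) Y Y)
    (hspec : TopDyn.HasSpecification (hinv.restrict (T^[k]) Y Y)) :
    ∃ E : Set X, Links T E k := by
  have : CompactSpace Y := isCompact_iff_compactSpace.1 hY.isCompact
  have hS : Continuous (hinv.restrict (T^[k]) Y Y) := (hT.iterate k).restrict hinv
  have hval : ∀ (n : ℕ) (y : Y),
      (((hinv.restrict (T^[k]) Y Y)^[n] y : Y) : X) = T^[k * n] (y : X) := by
    intro n
    induction n with
    | zero => intro y; rfl
    | succ n ih =>
      intro y
      rw [Function.iterate_succ_apply, ih, Set.MapsTo.val_restrict_apply,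
        ← Function.iterate_add_apply, Nat.mul_succ]
  refine ⟨Subtype.val '' TopDyn.eventualImage (hinv.restrict (T^[k]) Y Y),
    (isCompact_eventualImage hS).image continuous_subtype_val,
    hspec.nontrivial.image Subtype.val_injective, ?_, fun ε hε => ?_⟩
  · rintro _ ⟨y, hy, rfl⟩
    exact ⟨_, mapsTo_eventualImage _ hy, rfl⟩
  obtain ⟨δ, hδ, hmod⟩ := exists_modulus_iterate hT k hε
  obtain ⟨u, hu⟩ := exists_glue_infinite hS hspec hδ
  refine ⟨k * u, dvd_mul_right _ _, fun x r hx hr => ?_⟩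
  choose y hyE hyx using hx
  choose q hq using fun i => (hr i).1
  have hq0 : ∀ i, 1 ≤ q i := fun i => Nat.pos_of_ne_zero fun h0 => by
    have := (hr i).2
    rw [hq i, h0] at this
    exact absurd this (by simp)
  obtain ⟨z, hzE, hz⟩ := hu y q hyE hq0
  refine ⟨z, ⟨z, hzE, rfl⟩, fun i j hj => ?_⟩
  have hjq : j / k < q i := Nat.div_lt_of_lt_mul (by rw [← hq i]; exact hj)
  have h1 := hz i (j / k) hjq
  rw [Subtype.dist_eq, hval, hval, hyx] at h1
  have h2 := hmod (j % k) (Nat.mod_lt _ hk) _ _ h1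
  rw [← Function.iterate_add_apply, ← Function.iterate_add_apply, Nat.mod_add_div] at h2
  convert h2 using 3
  have hs : ∑ m ∈ Finset.range i, (r m + k * u) = k * ∑ m ∈ Finset.range i, (q m + u) := by
    rw [Finset.mul_sum]
    exact Finset.sum_congr rfl fun m _ => by rw [hq m, mul_add]
  have hdiv := Nat.mod_add_div j k
  rw [hs, mul_add]
  linarith

/-! ### An orbit that avoids a ball -/

/-- `T^V` acts on `E` transitively when `k ∣ V`: a closed `T^V`-invariant set with interior in `E`
contains `E`. -/
theorem Links.subset_of_interior_nonempty {X : Type*} [MetricSpace X] {T : X → X}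
    {E : Set X} {k : ℕ} (hE : Links T E k) {V : ℕ} (hkV : k ∣ V) (hV : 0 < V)
    {C : Set X} (hC : IsClosed C) (hCV : Set.MapsTo (T^[V]) C C)
    {y : X} (hy : y ∈ E) {δ : ℝ} (hδ : 0 < δ) (hball : ∀ z ∈ E, dist z y < δ → z ∈ C) :
    E ⊆ C := by
  intro x hx
  rw [← hC.closure_eq, Metric.mem_closure_iff]
  intro δ' hδ'
  obtain ⟨g, hkg, hg⟩ := hE.exists_glue (min δ δ') (lt_min hδ hδ')
  -- The first piece has length `V * (g + 1) - g`, so that the second one starts at a multiple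
  -- of `V`.
  have hle : g < V * (g + 1) := by nlinarith
  obtain ⟨z, hzE, hz⟩ := hg (fun i => if i = 0 then y else x) (fun _ => V * (g + 1) - g)
    (fun i => by split_ifs <;> assumption)
    (fun i => ⟨Nat.dvd_sub (dvd_mul_of_dvd_left hkV _) hkg, Nat.sub_pos_of_lt hle⟩)
  have h0 := hz 0 0 (Nat.sub_pos_of_lt hle)
  have h1 := hz 1 0 (Nat.sub_pos_of_lt hle)
  simp only [Finset.range_zero, Finset.sum_empty, add_zero, Function.iterate_zero, id_eq,
    if_true, Finset.range_one, Finset.sum_singleton, Nat.sub_add_cancel hle.le, one_ne_zero,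
    if_false] at h0 h1
  refine ⟨_, ?_, by rw [dist_comm]; exact h1.trans_le (min_le_right _ _)⟩
  rw [Function.iterate_mul]
  exact hCV.iterate _ (hball z hzE (h0.trans_le (min_le_left _ _)))

/-- Some point of `E` has a `T`-orbit whose closure does not contain `E`. -/
theorem exists_orbit_avoiding {X : Type*} [MetricSpace X] [CompactSpace X] {T : X → X}
    (hT : Continuous T) {E : Set X} {k : ℕ} (hk : 0 < k) (hE : Links T E k) :
    ∃ a ∈ E, ∃ w ∈ E, ∃ ρ > 0, ∀ n, ρ ≤ dist (T^[n] a) w := by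
  obtain ⟨p, hp, q, hq, hpq⟩ := hE.nontrivial
  have hd : 0 < dist p q := dist_pos.2 hpq
  obtain ⟨g, hkg, hg⟩ := hE.exists_glue (dist p q / 2) (half_pos hd)
  set V := k + g with hVdef
  have hV : 0 < V := by omega
  have hkV : k ∣ V := (dvd_refl k).add hkg
  obtain ⟨a, haE, ha⟩ := hg (fun _ => p) (fun _ => k) (fun _ => hp) (fun _ => ⟨dvd_rfl, hk⟩)
  let M : Set X := E ∩ {x | ∀ i, dist (T^[i * V] x) p ≤ dist p q / 2}
  have hMclosed : IsClosed M := by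
    refine hE.isCompact.isClosed.inter ?_
    rw [Set.ofPred_forall]
    exact isClosed_iInter fun i =>
      isClosed_le ((hT.iterate _).dist continuous_const) continuous_const
  have hEV : Set.MapsTo (T^[V]) E E := by
    obtain ⟨c, hc⟩ := hkV
    rw [hc, Function.iterate_mul]
    exact hE.mapsTo.iterate c
  have hMV : Set.MapsTo (T^[V]) M M := by
    refine fun x hx => ⟨hEV hx.1, fun i => ?_⟩
    rw [← Function.iterate_add_apply, ← Nat.succ_mul]
    exact hx.2 _
  have haM : a ∈ M := by
    refine ⟨haE, fun i => ?_⟩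
    have := ha i 0 hk
    simp only [Finset.sum_const, Finset.card_range, smul_eq_mul, add_zero,
      Function.iterate_zero, id_eq] at this
    exact this.le
  have hTM : ∀ s, IsClosed (T^[s] '' M) := fun s =>
    (hMclosed.isCompact.image (hT.iterate s)).isClosed
  by_contra! hcon
  -- Otherwise the orbit of `a` is dense in `E`, so finitely many closed sets `T^s M` cover `E`.
  have hcover : E ⊆ ⋃ s : Fin V, T^[s] '' M := by
    intro w hw
    rw [← (isClosed_iUnion_of_finite fun s : Fin V => hTM s).closure_eq, Metric.mem_closure_iff]
    intro ε hε
    obtain ⟨n, hn⟩ := hcon a haE w hw ε hε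
    refine ⟨T^[n] a, Set.mem_iUnion.2 ⟨⟨n % V, Nat.mod_lt _ hV⟩, T^[V * (n / V)] a, ?_, ?_⟩, ?_⟩
    · rw [Function.iterate_mul]
      exact hMV.iterate _ haM
    · rw [← Function.iterate_add_apply, Nat.mod_add_div]
    · rwa [dist_comm]
  have : CompactSpace E := isCompact_iff_compactSpace.1 hE.isCompact
  have : Nonempty E := ⟨⟨p, hp⟩⟩
  obtain ⟨s, y, hy⟩ := nonempty_interior_of_iUnion_of_closed
    (f := fun s : Fin V => (Subtype.val ⁻¹' (T^[s] '' M) : Set E))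
    (fun s => (hTM s).preimage continuous_subtype_val)
    (Set.eq_univ_of_forall fun z => by
      obtain ⟨s, hs⟩ := Set.mem_iUnion.1 (hcover z.2)
      exact Set.mem_iUnion.2 ⟨s, hs⟩)
  obtain ⟨δ, hδ, hball⟩ := Metric.mem_nhds_iff.1 (mem_interior_iff_mem_nhds.1 hy)
  have hcomm : ∀ (m n : ℕ) (x : X), T^[m] (T^[n] x) = T^[n] (T^[m] x) := fun m n x => by
    rw [← Function.iterate_add_apply, ← Function.iterate_add_apply, add_comm]
  have hsub : E ⊆ T^[s] '' M := by
    refine hE.subset_of_interior_nonempty hkV hV (hTM s) ?_ y.2 hδ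
      (fun z hz hzy => hball (show (⟨z, hz⟩ : E) ∈ Metric.ball y δ from hzy))
    rintro _ ⟨x, hx, rfl⟩
    exact ⟨T^[V] x, hMV hx, hcomm _ _ _⟩
  -- Iterating `E ⊆ T^s M ⊆ T^s E` gives `E ⊆ T^(V s) M ⊆ M`, but `q ∉ M`.
  have hiter : ∀ m : ℕ, E ⊆ T^[s * (m + 1)] '' M := by
    intro m
    induction m with
    | zero => simpa using hsub
    | succ m ih =>
      intro x hx
      obtain ⟨x₁, hx₁, rfl⟩ := hsub hx
      obtain ⟨x₂, hx₂, rfl⟩ := ih hx₁.1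
      exact ⟨x₂, hx₂, by rw [← Function.iterate_add_apply]; congr 1; ring_nf⟩
  obtain ⟨x, hx, hxq⟩ := hiter (V - 1) hq
  rw [Nat.sub_add_cancel hV, mul_comm, Function.iterate_mul] at hxq
  have hqM : q ∈ M := hxq ▸ hMV.iterate _ hx
  have := hqM.2 0
  rw [Nat.zero_mul, Function.iterate_zero, id_eq, dist_comm] at this
  linarith

/-! ### Segments with a first and a last visit to a ball -/

/-- Among `Q + 1` disjoint open subintervals of equal length `(β - α) / (Q + 1)`, centred at the
points `θ`, one avoids a given set of at most `Q` reals. -/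
theorem exists_gap_of_card_le (s : Finset ℝ) {Q : ℕ} (hs : s.card ≤ Q) {α β : ℝ} (h : α < β) :
    ∃ θ, α ≤ θ - (β - α) / (2 * (Q + 1)) ∧ θ + (β - α) / (2 * (Q + 1)) ≤ β ∧
      ∀ t ∈ s, t ≤ θ - (β - α) / (2 * (Q + 1)) ∨ θ + (β - α) / (2 * (Q + 1)) ≤ t := by
  have hQ : (0 : ℝ) < 2 * (Q + 1) := by positivity
  set η := (β - α) / (2 * (Q + 1)) with hη
  have hη0 : 0 < η := div_pos (sub_pos.2 h) hQ
  have hmul : η * (2 * (Q + 1)) = β - α := div_mul_cancel₀ _ hQ.ne'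
  obtain ⟨m, hm, hms⟩ := Finset.exists_mem_notMem_of_card_lt_card
    (s := s.image fun t => ⌊(t - α) / (2 * η)⌋₊) (t := Finset.range (Q + 1))
    (by rw [Finset.card_range]; exact (Finset.card_image_le.trans hs).trans_lt (Nat.lt_succ_self Q))
  have hmQ : (m : ℝ) ≤ Q := by
    exact_mod_cast Nat.lt_succ_iff.1 (Finset.mem_range.1 hm)
  have hm0 : (0 : ℝ) ≤ m := Nat.cast_nonneg m
  refine ⟨α + 2 * η * m + η, by nlinarith, by nlinarith, fun t ht => ?_⟩
  by_contra! hcon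
  refine hms (Finset.mem_image.2 ⟨t, ht, ?_⟩)
  have h2η : 0 < 2 * η := by positivity
  rw [Nat.floor_eq_iff (div_nonneg (by nlinarith) h2η.le), le_div_iff₀ h2η, div_lt_iff₀ h2η]
  constructor <;> nlinarith

/-- Call `n` a visit if `T^n e` is within `θ - η` of `w`. The orbit segment of `e` of length `R` does
not meet the open shell of radii `θ - η` and `θ + η` around `w`, its first visit is at time `v`, its
last at time `v + Δ`, and the time before the first and after the last visit is longer than `Δ`. -/
structure IsMarkedSegment {X : Type*} [MetricSpace X] (T : X → X) (w e : X) (θ η : ℝ)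
    (R v Δ : ℕ) : Prop where
  dichotomy : ∀ n < R, dist (T^[n] e) w ≤ θ - η ∨ θ + η ≤ dist (T^[n] e) w
  first : dist (T^[v] e) w ≤ θ - η
  last : dist (T^[v + Δ] e) w ≤ θ - η
  mem_Icc : ∀ n < R, dist (T^[n] e) w ≤ θ - η → v ≤ n ∧ n ≤ v + Δ
  lt_first : Δ < v
  lt_length : v + Δ + Δ < R

/-- The thickness `η` is chosen before the lower bound `D` on the distance of the two visits, so that
`D` may later be taken larger than the gap needed to glue at scale `η`. -/
theorem Links.exists_isMarkedSegment {X : Type*} [MetricSpace X] {T : X → X} {E : Set X} {k : ℕ}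
    (hk : 0 < k) (hE : Links T E k) {a w : X} (ha : a ∈ E) (hw : w ∈ E) {ρ : ℝ} (hρ : 0 < ρ)
    (haw : ∀ n, ρ ≤ dist (T^[n] a) w) :
    ∃ η > 0, ∀ D : ℕ, ∃ e ∈ E, ∃ (θ : ℝ) (R v Δ : ℕ), k ∣ R ∧ D ≤ Δ ∧ θ + η ≤ ρ ∧
      IsMarkedSegment T w e θ η R v Δ := by
  obtain ⟨g, hkg, hg⟩ := hE.exists_glue (ρ / 4) (by positivity)
  set Q := 2 * (2 * g + k) with hQ
  refine ⟨(3 * ρ / 4 - ρ / 4) / (2 * ((Q : ℝ) + 1)), div_pos (by linarith) (by positivity),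
    fun D₀ => ?_⟩
  -- Round `D₀` up to a positive multiple `D` of `k`.
  obtain ⟨D, hkD, hD₀, hD⟩ : ∃ D, k ∣ D ∧ D₀ ≤ D ∧ 0 < D :=
    ⟨k * (D₀ + 1), dvd_mul_right _ _, by nlinarith, by positivity⟩
  obtain ⟨r, hkr, hr⟩ : ∃ r, k ∣ r ∧ D + 4 * g + 2 * k < r :=
    ⟨k * (D + 4 * g + 2 * k + 1), dvd_mul_right _ _, by nlinarith⟩
  -- The pieces: a run of `a` of length `r`, one visit to `w`, a run of `a` of length `D`, another
  -- visit to `w`, and again a run of `a` of length `r`. The remaining pieces play no role.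
  obtain ⟨e, heE, he⟩ := hg
    (fun i => match i with | 1 => w | 3 => w | _ => a)
    (fun i => match i with | 1 => k | 2 => D | 3 => k | _ => r)
    (fun i => by split <;> assumption)
    (fun i => by
      split
      · exact ⟨dvd_rfl, hk⟩
      · exact ⟨hkD, hD⟩
      · exact ⟨dvd_rfl, hk⟩
      · exact ⟨hkr, by omega⟩)
  have h0 := he 0
  have h1 := he 1 0 hk
  have h2 := he 2
  have h3 := he 3 0 hk
  have h4 := he 4
  simp only [Finset.sum_range_succ, Finset.range_zero, Finset.sum_empty, zero_add, add_zero,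
    Function.iterate_zero, id_eq] at h0 h1 h2 h3 h4
  have hfar : ∀ {m j : ℕ}, dist (T^[m] e) (T^[j] a) < ρ / 4 → 3 * ρ / 4 ≤ dist (T^[m] e) w := by
    intro m j h
    have := dist_triangle_left (T^[j] a) w (T^[m] e)
    linarith [haw j]
  set t₁ := r + g with ht₁
  set t₂ := r + g + (k + g) with ht₂
  set t₃ := r + g + (k + g) + (D + g) with ht₃
  set t₄ := r + g + (k + g) + (D + g) + (k + g) with ht₄
  set R := t₄ + r with hR
  -- The two windows in which the orbit of `e` is not known to be far from `w`; together they have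
  -- `Q` elements, whatever `D` is.
  set W := Finset.Ico r t₂ ∪ Finset.Ico (t₂ + D) t₄ with hW
  have hWcard : (W.image fun n => dist (T^[n] e) w).card ≤ Q := by
    refine Finset.card_image_le.trans ((Finset.card_union_le _ _).trans ?_)
    rw [Nat.card_Ico, Nat.card_Ico]
    omega
  obtain ⟨θ, hθ₁, hθ₂, hθ⟩ := exists_gap_of_card_le _ hWcard
    (show ρ / 4 < 3 * ρ / 4 by linarith)
  have hη0 : 0 < (3 * ρ / 4 - ρ / 4) / (2 * ((Q : ℝ) + 1)) :=
    div_pos (by linarith) (by positivity)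
  set η := (3 * ρ / 4 - ρ / 4) / (2 * ((Q : ℝ) + 1)) with hη
  have hout : ∀ n < R, n ∉ W → 3 * ρ / 4 ≤ dist (T^[n] e) w := by
    intro n hn hnW
    simp only [hW, Finset.mem_union, Finset.mem_Ico, not_or, not_and, not_lt] at hnW
    rcases lt_or_ge n r with hnr | hnr
    · exact hfar (h0 n hnr)
    rcases lt_or_ge n (t₂ + D) with hn2 | hn2
    · have := h2 (n - t₂) (by omega)
      rw [Nat.add_sub_cancel' (hnW.1 hnr)] at this
      exact hfar this
    · have := h4 (n - t₄) (by omega)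
      rw [Nat.add_sub_cancel' (hnW.2 hn2)] at this
      exact hfar this
  set P := (Finset.range R).filter fun n => dist (T^[n] e) w ≤ θ - η with hP
  have hPmem : ∀ n, n ∈ P ↔ n < R ∧ dist (T^[n] e) w ≤ θ - η := by
    intro n; simp [hP]
  have hPW : ∀ n ∈ P, r ≤ n ∧ n < t₄ := by
    intro n hn
    rw [hPmem] at hn
    have hnW : n ∈ W := by
      by_contra hnW
      linarith [hout n hn.1 hnW]
    simp only [hW, Finset.mem_union, Finset.mem_Ico] at hnW
    omega
  have h1P : t₁ ∈ P := (hPmem _).2 ⟨by omega, h1.le.trans hθ₁⟩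
  have h3P : t₃ ∈ P := (hPmem _).2 ⟨by omega, h3.le.trans hθ₁⟩
  have hne : P.Nonempty := ⟨_, h1P⟩
  have hv1 := P.min'_le _ h1P
  have hv3 := P.le_max' _ h3P
  have hmin := P.min'_mem hne
  have hmax := P.max'_mem hne
  have hminW := hPW _ hmin
  have hmaxW := hPW _ hmax
  set v := P.min' hne with hv
  set v' := P.max' hne with hv'
  have hvv : v + (v' - v) = v' := by omega
  refine ⟨e, heE, θ, R, v, v' - v, ?_, by omega, by linarith, ?_, ?_, ?_, ?_, by omega, by omega⟩
  · have h := (((hkr.add hkg).add ((dvd_refl k).add hkg)).add (hkD.add hkg)).add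
      ((dvd_refl k).add hkg)
    exact h.add hkr
  · intro n hn
    by_cases hnW : n ∈ W
    · exact hθ _ (Finset.mem_image_of_mem _ hnW)
    · exact Or.inr (hθ₂.trans (hout n hn hnW))
  · exact ((hPmem _).1 hmin).2
  · rw [hvv]; exact ((hPmem _).1 hmax).2
  · intro n hn h
    have hnP := (hPmem n).2 ⟨hn, h⟩
    rw [hvv]
    exact ⟨P.min'_le _ hnP, P.le_max' _ hnP⟩

/-! ### A continuous function reading off prescribed times -/

/-- The full coding: any subset of a residue class modulo `L` is the set of times at which some orbit
meets `F = 1`, with `F = 0` at all other times. -/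
theorem exists_continuous_indicator_of_residue {X : Type*} [MetricSpace X] [CompactSpace X]
    {T : X → X} (hT : Continuous T) {E : Set X} {k : ℕ} (hk : 0 < k) (hE : Links T E k) :
    ∃ L > 0, ∃ F : C(X, ℝ), ∀ l < L, ∀ P : Set ℕ, (∀ n ∈ P, n % L = l) →
      ∃ x, ∀ n, F (T^[n] x) = P.indicator 1 n := by
  classical
  obtain ⟨a, ha, w, hw, ρ, hρ, haw⟩ := exists_orbit_avoiding hT hk hE
  obtain ⟨η, hη, hseg⟩ := hE.exists_isMarkedSegment hk ha hw hρ haw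
  obtain ⟨g, -, hg⟩ := hE.exists_glue (η / 2) (half_pos hη)
  obtain ⟨e, he, θ, R, v, Δ, hkR, hgΔ, hθρ, hS⟩ := hseg g
  have hlt := hS.lt_first
  have hltR := hS.lt_length
  let h : X → ℝ := fun x => max 0 (min 1 ((θ + η / 2 - dist x w) / η))
  have hcont : Continuous h := by fun_prop
  have hone : ∀ x, dist x w ≤ θ - η / 2 → h x = 1 := by
    intro x hx
    have : 1 ≤ (θ + η / 2 - dist x w) / η := by rw [le_div_iff₀ hη]; linarith
    simp only [h, min_eq_left this, max_eq_right zero_le_one]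
  have hzero : ∀ x, θ + η / 2 ≤ dist x w → h x = 0 := by
    intro x hx
    have h1 : (θ + η / 2 - dist x w) / η ≤ 0 := div_nonpos_of_nonpos_of_nonneg (by linarith) hη.le
    exact max_eq_left ((min_le_right _ _).trans h1)
  refine ⟨R + g, by omega, ⟨fun x => h x * h (T^[Δ] x),
    hcont.mul (hcont.comp (hT.iterate Δ))⟩, fun l hl P hP => ?_⟩
  set L := R + g with hL
  have hL0 : 0 < L := by omega
  -- `ω i` says that the `i`-th piece is a copy of `e`. The marker of the `0`-th piece would fall at
  -- the negative time `l - L` after the final shift, so that piece is always a run of `a`.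
  let ω : ℕ → Prop := fun i => 0 < i ∧ l + (i - 1) * L ∈ P
  obtain ⟨z, -, hz⟩ := hg (fun i => if ω i then e else a) (fun _ => R)
    (fun i => by split_ifs <;> assumption) (fun i => ⟨hkR, by omega⟩)
  simp only [Finset.sum_const, Finset.card_range, smul_eq_mul] at hz
  have hhit : ∀ i, ∀ j < R, ω i → dist (T^[j] e) w ≤ θ - η → h (T^[i * L + j] z) = 1 := by
    intro i j hj hi hd
    have h1 := hz i j hj
    rw [if_pos hi] at h1
    have := dist_triangle (T^[i * L + j] z) (T^[j] e) w
    exact hone _ (by linarith)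
  have hmiss : ∀ i, ∀ j < R, h (T^[i * L + j] z) ≠ 0 → ω i ∧ v ≤ j ∧ j ≤ v + Δ := by
    intro i j hj hne
    have h1 := hz i j hj
    have h2 := dist_triangle_left (T^[j] (if ω i then e else a)) w (T^[i * L + j] z)
    have h3 : dist (T^[j] (if ω i then e else a)) w < θ + η := by
      by_contra! h3
      exact hne (hzero _ (by linarith))
    by_cases hi : ω i
    · rw [if_pos hi] at h3
      exact ⟨hi, hS.mem_Icc j hj ((hS.dichotomy j hj).resolve_right h3.not_ge)⟩
    · rw [if_neg hi] at h3
      linarith [haw j]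
  have hkey : ∀ i, ∀ j < L, h (T^[i * L + j] z) * h (T^[Δ] (T^[i * L + j] z)) =
      if j = v ∧ ω i then 1 else 0 := by
    intro i j hj
    rw [← Function.iterate_add_apply, show Δ + (i * L + j) = i * L + (j + Δ) by omega]
    split_ifs with hji
    · obtain ⟨rfl, hi⟩ := hji
      rw [hhit i j (by omega) hi hS.first, hhit i _ (by omega) hi hS.last, one_mul]
    · by_contra hne
      obtain ⟨hne1, hne2⟩ := mul_ne_zero_iff.1 hne
      rcases lt_or_ge j R with hjR | hjR
      · obtain ⟨hi, hj1, hj2⟩ := hmiss i j hjR hne1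
        obtain ⟨-, hj3, hj4⟩ := hmiss i (j + Δ) (by omega) hne2
        exact hji ⟨by omega, hi⟩
      · -- `j` lies in the gap, so `j + Δ` lies in the initial run of the next piece.
        have : i * L + (j + Δ) = (i + 1) * L + (j + Δ - L) := by
          rw [Nat.succ_mul]; omega
        rw [this] at hne2
        obtain ⟨-, hj1, -⟩ := hmiss (i + 1) (j + Δ - L) (by omega) hne2
        omega
  -- Shift `z` so that the markers of its pieces move to the residue class `l`.
  refine ⟨T^[v + L - l] z, fun n => ?_⟩
  have hdiv := Nat.div_add_mod (n + (v + L - l)) L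
  have hmod := Nat.mod_lt (n + (v + L - l)) hL0
  have hkn := hkey ((n + (v + L - l)) / L) _ hmod
  rw [mul_comm _ L, hdiv, Function.iterate_add_apply] at hkn
  refine Eq.trans hkn ?_
  set i := (n + (v + L - l)) / L with hi
  set j := (n + (v + L - l)) % L with hj
  rw [Set.indicator_apply, Pi.one_apply]
  congr 1
  refine propext ⟨fun ⟨hjv, hi0, hiP⟩ => ?_, fun hn => ?_⟩
  · obtain ⟨i', hi'⟩ := Nat.exists_eq_succ_of_ne_zero hi0.ne'
    rw [hi', Nat.succ_sub_one, mul_comm] at hiP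
    rw [hi', Nat.mul_succ] at hdiv
    convert hiP using 1
    omega
  · have hnl := hP n hn
    have hdn := Nat.div_add_mod n L
    have hs : n + (v + L - l) = v + L * (n / L + 1) := by rw [Nat.mul_succ]; omega
    have hjv : j = v := by
      rw [hj, hs, Nat.add_mul_mod_self_left, Nat.mod_eq_of_lt (by omega)]
    have hin : i = n / L + 1 := by
      rw [hi, hs, Nat.add_mul_div_left _ _ hL0, Nat.div_eq_of_lt (by omega), zero_add]
    refine ⟨hjv, hin ▸ Nat.succ_pos _, ?_⟩
    rw [hin, Nat.add_sub_cancel, mul_comm]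
    convert hn using 1
    omega

/-! ### Bohr chaos -/

/-- The averages are bounded and nonnegative, so a nonpositive `limsup` forces convergence. -/
theorem tendsto_average_zero_of_limsup_nonpos {b : ℕ → ℝ} {C : ℝ} (hb : ∀ n, |b n| ≤ C)
    (h : limsup (fun N : ℕ => (1 / (N : ℝ)) * |∑ n ∈ Finset.range N, b n|) atTop ≤ 0) :
    Tendsto (fun N : ℕ => (1 / (N : ℝ)) * |∑ n ∈ Finset.range N, b n|) atTop (𝓝 0) := by
  have h0 : ∀ N : ℕ, 0 ≤ (1 / (N : ℝ)) * |∑ n ∈ Finset.range N, b n| := fun N => by positivity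
  have hC : 0 ≤ C := (abs_nonneg _).trans (hb 0)
  have hle : ∀ N : ℕ, (1 / (N : ℝ)) * |∑ n ∈ Finset.range N, b n| ≤ C := by
    intro N
    rcases Nat.eq_zero_or_pos N with rfl | hN
    · simpa using hC
    have hN' : (0 : ℝ) < N := by exact_mod_cast hN
    rw [one_div, inv_mul_le_iff₀ hN']
    refine (Finset.abs_sum_le_sum_abs _ _).trans ((Finset.sum_le_card_nsmul _ _ C
      fun n _ => hb n).trans_eq ?_)
    rw [Finset.card_range, nsmul_eq_mul]
  have hbdd : IsBoundedUnder (· ≤ ·) atTop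
      (fun N : ℕ => (1 / (N : ℝ)) * |∑ n ∈ Finset.range N, b n|) := isBoundedUnder_of ⟨C, hle⟩
  have hbdd' : IsBoundedUnder (· ≥ ·) atTop
      (fun N : ℕ => (1 / (N : ℝ)) * |∑ n ∈ Finset.range N, b n|) := isBoundedUnder_of ⟨0, h0⟩
  exact tendsto_of_le_liminf_of_limsup_le
    (le_liminf_of_le hbdd.isCoboundedUnder_ge (Eventually.of_forall h0)) h hbdd hbdd'

theorem isBohrChaotic_of_indicator {X : Type*} [MetricSpace X] [CompactSpace X] {T : X → X}
    {L : ℕ} (hL : 0 < L) (F : C(X, ℝ))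
    (hF : ∀ l < L, ∀ P : Set ℕ, (∀ n ∈ P, n % L = l) → ∃ x, ∀ n, F (T^[n] x) = P.indicator 1 n) :
    TopDyn.IsBohrChaotic T := by
  classical
  rintro a ⟨C, hC⟩ hnt
  by_contra! hcon
  have hC0 : 0 ≤ C := (abs_nonneg _).trans (hC 0)
  have hzero : ∀ l < L, ∀ P : Set ℕ, (∀ n ∈ P, n % L = l) →
      Tendsto (fun N : ℕ => (1 / (N : ℝ)) * |∑ n ∈ Finset.range N, P.indicator a n|)
        atTop (𝓝 0) := by
    intro l hl P hP
    obtain ⟨x, hx⟩ := hF l hl P hP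
    have hind : ∀ n, a n * F (T^[n] x) = P.indicator a n := fun n => by
      rw [hx]
      by_cases hn : n ∈ P <;> simp [hn]
    have := hcon x F
    simp only [hind] at this
    refine tendsto_average_zero_of_limsup_nonpos (C := C) (fun n => ?_) this
    by_cases hn : n ∈ P <;> simp [hn, hC, hC0]
  let pos : ℕ → Set ℕ := fun l => {n | n % L = l ∧ 0 ≤ a n}
  let neg : ℕ → Set ℕ := fun l => {n | n % L = l ∧ a n < 0}
  have hsum := tendsto_finsetSum (Finset.range L) fun l hl =>
    (hzero l (Finset.mem_range.1 hl) (pos l) fun n hn => hn.1).add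
      (hzero l (Finset.mem_range.1 hl) (neg l) fun n hn => hn.1)
  simp only [add_zero, Finset.sum_const_zero] at hsum
  have hpt : ∀ n, |a n| = ∑ l ∈ Finset.range L, ((pos l).indicator a n - (neg l).indicator a n) := by
    intro n
    rw [Finset.sum_eq_single_of_mem (n % L) (Finset.mem_range.2 (Nat.mod_lt _ hL))
      (fun l _ hl => by simp [pos, neg, hl.symm])]
    rcases le_or_gt 0 (a n) with h | h
    · simp [pos, neg, h, abs_of_nonneg, h.not_gt]
    · simp [pos, neg, h, abs_of_neg, h.not_ge]
  have hle : ∀ N : ℕ, (1 / (N : ℝ)) * ∑ n ∈ Finset.range N, |a n| ≤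
      ∑ l ∈ Finset.range L, ((1 / (N : ℝ)) * |∑ n ∈ Finset.range N, (pos l).indicator a n| +
        (1 / (N : ℝ)) * |∑ n ∈ Finset.range N, (neg l).indicator a n|) := by
    intro N
    rw [Finset.sum_congr rfl fun n _ => hpt n, Finset.sum_comm, Finset.mul_sum]
    refine Finset.sum_le_sum fun l _ => ?_
    rw [← mul_add, Finset.sum_sub_distrib]
    refine mul_le_mul_of_nonneg_left ?_ (by positivity)
    exact (le_abs_self _).trans (abs_sub _ _)
  have hlim : Tendsto (fun N : ℕ => (1 / (N : ℝ)) * ∑ n ∈ Finset.range N, |a n|) atTop (𝓝 0) :=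
    squeeze_zero (fun N => by positivity) hle hsum
  rw [TopDyn.IsNontrivialSeq, hlim.limsup_eq] at hnt
  exact lt_irrefl 0 hnt

theorem theorem4p2p3 {X : Type*} [MetricSpace X] [CompactSpace X]
    (T : X → X) (hT : Continuous T)
    (Y : Set X) (hY : IsClosed Y)
    (k : ℕ) (hk : 0 < k) (hinv : Set.MapsTo (T^[k]) Y Y)
    (hspec : TopDyn.HasSpecification (hinv.restrict (T^[k]) Y Y)) :
    TopDyn.IsBohrChaotic T := by
  obtain ⟨E, hE⟩ := links_of_hasSpecification hT hY hk hinv hspec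
  obtain ⟨L, hL, F, hF⟩ := exists_continuous_indicator_of_residue hT hk hE
  exact isBohrChaotic_of_indicator hL F hF
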